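/- For a group $H$, let $S(H)$ be the set of classes $[\psi]$ of non-zero homomorphisms $\psi:H\to\mathbb R$, where $[\psi]=[\psi']$ if and only if $\psi=\lambda\psi'$ for some $\lambda>0$. If $H$ is finitely generated, its BNS invariant $\Sigma(H)\subset S(H)$ is the set of classes $[\psi]$ such that, for some (equivalently, every) finite generating set $\mathcal H$ of $H$, the full subgraph of the Cayley graph $\mathrm{Cay}(H,\mathcal H)$ (with edges joining $h$ and $hs$, for $h\in H$ and $s\in\mathcal H$) spanned by the vertices $h$ with $\psi(h)\ge 0$ is connected. Let $\varsigma$ be the class of finitely generated groups $H$ with $\Sigma(H)=S(H)$. A graph of groups $\Gamma$ has a connected underlying graph, vertex groups $G_v$, edge groups $G_e$, and injections of each $G_e$ into the vertex groups at the two endpoints of $e$. It is reduced if, for every edge $e$ with distinct endpoints $v_1,v_2$, both inclusions $G_e\hookrightarrow G_{v_1}$ and $G_e\hookrightarrow G_{v_2}$ are proper. It is called an ascending HNN-extension here if it has exactly one vertex and exactly one edge, and at least one of the two inclusions of the edge group into the vertex group is onto. Let $G$ be the fundamental group of a finite reduced graph of groups $\Gamma$ that is not an ascending HNN-extension (in the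 sense just given). Assume that $G$ is finitely generated and that all edge groups of $\Gamma$ belong to $\varsigma$. Then every vertex group $G_v$ is finitely generated, and for every non-zero homomorphism $\varphi:G\to\mathbb R$ we have $[\varphi]\in\Sigma(G)$ if and only if $\varphi$ is non-trivial on every edge group $G_e$ and, for every vertex $v$, the restriction $\varphi|_{G_v}$ is non-zero and $[\varphi|_{G_v}]\in\Sigma(G_v)$. Equivalently, $$\Sigma(G)=\bigcap_{e}S(G,G_e)^c\ \cap\ \bigcap_{v}(\iota_{G_v}^*)^{-1}(\Sigma(G_v)),$$ where $e$ and $v$ range over the edges and vertices of $\Gamma$, $S(G,H)=\{[\varphi]\in S(G): H\subset\ker\varphi\}$, $S(G,H)^c$ is its complement in $S(G)$, and $\iota_{G_v}^*:S(G,G_v)^c\to S(G_v)$ is the restriction map $[\varphi]\mapsto[\varphi|_{G_v}]$. -/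

import Mathlib

noncomputable section

namespace BNS

/-! ### The character sphere and the Bieri-Neumann-Strebel invariant -/

/-- The additive group of characters `Hom(G, ℝ)`, as a real vector space. -/
abbrev Character (G : Type*) [Group G] : Type _ := Additive G →+ ℝ

/-- The sphere `S(G)` of classes `[φ]` of nonzero characters of `G`,
where `[φ] = [ψ]` if and only if `φ = c • ψ` for some `c > 0`. -/
abbrev CharSphere (G : Type*) [Group G] : Type _ := Module.Ray ℝ (Character G)

/-- The class `[φ]` of a nonzero character. -/
abbrev cls {G : Type*} [Group G] (φ : Character G) (h : φ ≠ 0) : CharSphere G :=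
  rayOfNeZero ℝ φ h

/-- Pullback of a character along a group homomorphism `f : H →* G`
(the restriction of `φ` to `H` when `f` is the inclusion of a subgroup). -/
def Character.res {G H : Type*} [Group G] [Group H] (φ : Character G) (f : H →* G) :
    Character H :=
  φ.comp (MonoidHom.toAdditive f)

/-- The full subgraph of the Cayley graph of `G` with respect to `S` (edges joining `g` and `g * s`
for `s ∈ S`) spanned by the vertices `g` with `0 ≤ φ g`. -/
def nonnegCayley {G : Type*} [Group G] (S : Set G) (φ : Character G) :
    SimpleGraph {g : G // 0 ≤ φ (Additive.ofMul g)} :=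
  (SimpleGraph.mulCayley S).induce {g : G | 0 ≤ φ (Additive.ofMul g)}

/-- The BNS invariant `Σ(G) ⊆ S(G)`: the class `[φ]` belongs to it if and only if, for some finite
generating set of `G`, the nonnegative part of the Cayley graph is connected. -/
def bnsInvariant (G : Type*) [Group G] : Set (CharSphere G) :=
  {x | ∃ (φ : Character G) (h : φ ≠ 0), cls φ h = x ∧
    ∃ S : Set G, S.Finite ∧ Subgroup.closure S = ⊤ ∧ (nonnegCayley S φ).Connected}

/-- The class `ς` of finitely generated groups `H` with `Σ(H) = S(H)`. -/
def InVarsigma (H : Type*) [Group H] : Prop :=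
  Group.FG H ∧ bnsInvariant H = Set.univ

/-- The subsphere `S(G, H)` of classes of characters vanishing on (the image of) `H`. -/
def vanishingSphere {G H : Type*} [Group G] [Group H] (f : H →* G) : Set (CharSphere G) :=
  {x | ∃ (φ : Character G) (h : φ ≠ 0), cls φ h = x ∧ φ.res f = 0}

theorem cls_mem_vanishingSphere {G H : Type*} [Group G] [Group H] (f : H →* G)
    (φ : Character G) (h : φ ≠ 0) : cls φ h ∈ vanishingSphere f ↔ φ.res f = 0 := by
  constructor
  · rintro ⟨ψ, hψ, he, hz⟩
    obtain ⟨a, b, ha, hb, hab⟩ := ((ray_eq_iff hψ h).1 he).exists_pos hψ h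
    refine DFunLike.ext _ _ fun g : Additive H => ?_
    have h1 := DFunLike.congr_fun hab (Additive.ofMul (f (Additive.toMul g)))
    have h2 : ψ (Additive.ofMul (f (Additive.toMul g))) = 0 := DFunLike.congr_fun hz g
    have h3 : b * φ (Additive.ofMul (f (Additive.toMul g))) = 0 := by
      have h4 : a * ψ (Additive.ofMul (f (Additive.toMul g))) =
          b * φ (Additive.ofMul (f (Additive.toMul g))) := h1
      rw [← h4, h2, mul_zero]
    exact (mul_eq_zero.1 h3).resolve_left hb.ne'
  · exact fun hz => ⟨φ, h, rfl, hz⟩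

theorem res_someVector_ne_zero {G H : Type*} [Group G] [Group H] (f : H →* G)
    (x : ((vanishingSphere f)ᶜ : Set (CharSphere G))) :
    Character.res x.1.someVector f ≠ 0 := fun h0 =>
  x.2 ⟨_, x.1.someVector_ne_zero, x.1.someVector_ray, h0⟩

/-- The restriction map `S(G, H)ᶜ → S(H)`, `[φ] ↦ [φ|_H]`
(see `resSphere_cls`: it does not depend on the representative). -/
def resSphere {G H : Type*} [Group G] [Group H] (f : H →* G)
    (x : ((vanishingSphere f)ᶜ : Set (CharSphere G))) : CharSphere H :=
  cls (Character.res x.1.someVector f) (res_someVector_ne_zero f x)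

theorem resSphere_cls {G H : Type*} [Group G] [Group H] (f : H →* G)
    (φ : Character G) (h : φ ≠ 0) (hf : φ.res f ≠ 0) :
    resSphere f ⟨cls φ h, fun hv => hf ((cls_mem_vanishingSphere f φ h).1 hv)⟩ =
      cls (φ.res f) hf := by
  refine (ray_eq_iff _ _).2 ?_
  have hs : SameRay ℝ (cls φ h).someVector φ :=
    (ray_eq_iff (cls φ h).someVector_ne_zero h).1 (cls φ h).someVector_ray
  obtain ⟨a, b, ha, hb, hab⟩ := hs.exists_pos (cls φ h).someVector_ne_zero h
  refine Or.inr (Or.inr ⟨a, b, ha, hb, ?_⟩)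
  refine DFunLike.ext _ _ fun g : Additive H => ?_
  exact DFunLike.congr_fun hab (Additive.ofMul (f (Additive.toMul g)))

/-! ### Graphs of groups -/

/-- A graph of groups with vertex set `V` and set of (geometric) edges `E`; each edge is given with
an orientation, and loops and multiple edges are allowed. -/
structure GraphOfGroups (V : Type*) (E : Type*) where
  /-- origin of an edge -/
  src : E → V
  /-- terminus of an edge -/
  tgt : E → V
  /-- the vertex groups `G_v` -/
  VGroup : V → Type*
  /-- the edge groups `G_e` -/
  EGroup : E → Type*
  [vGroupInst : ∀ v, Group (VGroup v)]
  [eGroupInst : ∀ e, Group (EGroup e)]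
  /-- the inclusion `G_e ↪ G_{src e}` -/
  srcHom : ∀ e, EGroup e →* VGroup (src e)
  /-- the inclusion `G_e ↪ G_{tgt e}` -/
  tgtHom : ∀ e, EGroup e →* VGroup (tgt e)
  srcHom_injective : ∀ e, Function.Injective (srcHom e)
  tgtHom_injective : ∀ e, Function.Injective (tgtHom e)

attribute [instance] GraphOfGroups.vGroupInst GraphOfGroups.eGroupInst

namespace GraphOfGroups

variable {V E : Type*}

/-- The simple graph on `V` underlying the subgraph with set of edges `T`. -/
def spanningGraph (Γ : GraphOfGroups V E) (T : Set E) : SimpleGraph V :=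
  SimpleGraph.fromRel fun v w => ∃ e ∈ T, Γ.src e = v ∧ Γ.tgt e = w

/-- `T` is the set of edges of a maximal (that is, spanning) tree of the underlying graph:
`T` has no loops and no multiple edges, and the resulting simple graph on `V` is a tree. -/
structure IsMaximalTree (Γ : GraphOfGroups V E) (T : Set E) : Prop where
  no_loops : ∀ e ∈ T, Γ.src e ≠ Γ.tgt e
  no_multiple : ∀ e ∈ T, ∀ e' ∈ T, s(Γ.src e, Γ.tgt e) = s(Γ.src e', Γ.tgt e') → e = e'
  isTree : (Γ.spanningGraph T).IsTree

/-- The free product of all vertex groups and of the free group on the edges. -/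
abbrev FreeProd (Γ : GraphOfGroups V E) : Type _ :=
  Monoid.Coprod (Monoid.CoprodI Γ.VGroup) (FreeGroup E)

/-- The vertex group `G_v` in the free product. -/
def preVertex (Γ : GraphOfGroups V E) (v : V) : Γ.VGroup v →* Γ.FreeProd :=
  Monoid.Coprod.inl.comp Monoid.CoprodI.of

/-- The stable letter `t_e` in the free product. -/
def preStable (Γ : GraphOfGroups V E) (e : E) : Γ.FreeProd :=
  Monoid.Coprod.inr (FreeGroup.of e)

/-- The relators of the fundamental group relative to `T`: those expressing
`t_e⁻¹ a t_e = σ_e(a)` for every edge `e` and every `a ∈ G_e` (where `a` is viewed in `G_{src e}`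
and `σ_e(a)` is its image in `G_{tgt e}`), and `t_e = 1` for `e ∈ T`. -/
def relators (Γ : GraphOfGroups V E) (T : Set E) : Set Γ.FreeProd :=
  {r | ∃ (e : E) (a : Γ.EGroup e),
      r = (Γ.preStable e)⁻¹ * Γ.preVertex (Γ.src e) (Γ.srcHom e a) * Γ.preStable e *
        (Γ.preVertex (Γ.tgt e) (Γ.tgtHom e a))⁻¹} ∪
  {r | ∃ e ∈ T, r = Γ.preStable e}

/-- The fundamental group `π₁(Γ, T)` of a graph of groups relative to a maximal tree `T`. -/
abbrev FundGroup (Γ : GraphOfGroups V E) (T : Set E) : Type _ :=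
  Γ.FreeProd ⧸ Subgroup.normalClosure (Γ.relators T)

/-- The canonical homomorphism `G_v → π₁(Γ, T)`. -/
def vertexHom (Γ : GraphOfGroups V E) (T : Set E) (v : V) : Γ.VGroup v →* Γ.FundGroup T :=
  (QuotientGroup.mk' _).comp (Γ.preVertex v)

/-- The canonical homomorphism `G_e → π₁(Γ, T)`, through the origin of `e`
(going through the terminus gives a conjugate homomorphism). -/
def edgeHom (Γ : GraphOfGroups V E) (T : Set E) (e : E) : Γ.EGroup e →* Γ.FundGroup T :=
  (Γ.vertexHom T (Γ.src e)).comp (Γ.srcHom e)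

/-- `Γ` is reduced: for an edge with distinct endpoints both inclusions are proper. -/
def IsReduced (Γ : GraphOfGroups V E) : Prop :=
  ∀ e, Γ.src e ≠ Γ.tgt e →
    ¬ Function.Surjective (Γ.srcHom e) ∧ ¬ Function.Surjective (Γ.tgtHom e)

/-- `Γ` is an ascending (or, for the opposite orientation, descending) HNN-extension: it has exactly
one vertex and exactly one edge, and at least one of the two inclusions of the edge group is onto
the vertex group. -/
def IsAscendingHNN (Γ : GraphOfGroups V E) : Prop :=
  Nat.card V = 1 ∧ Nat.card E = 1 ∧
    ∃ e, Function.Surjective (Γ.srcHom e) ∨ Function.Surjective (Γ.tgtHom e)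

end GraphOfGroups

end BNS

end

/-!
Write `G = π₁(Γ, T)`. A character is *coarsely connected* if, for some finite `S ⊆ G`, two elements
of `G` can always be joined by a path of `S`-edges along which the character drops only a bounded
amount below the lower end. For a nonzero character this says that its class lies in `Σ(G)`
(`cls_mem_bnsInvariant_iff`); for the zero character it says that `G` is finitely generated
(`coarselyConnected_zero_iff`). Hence the finite generation of the vertex groups and the statement
on `Σ` follow from the same theorem.

The geometric input is the Bass-Serre tree, which enters only through its half-spaces. A half-space
is a set of pairs `(g, w)`, standing for cosets `g G_w`, whose boundary consists of a single edge.
It is obtained without normal forms (`IsMaximalTree.exists_isWall`): the universal property of `G`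
gives an action on `G × ℤ` whose second coordinate counts the signed crossings of the edge.
Injectivity of `G_v → G` comes from iterated HNN-extensions (`exists_embedding`).

* *Vertex groups inherit coarse connectivity* (`IsMaximalTree.coarselyConnected_res`). A path in `G`
  between elements of `G_v` that leaves `G_v` through an edge returns through the same edge. Since
  the edge groups belong to `ς`, the excursion can be replaced by a path in a coset of the
  edge group that does not drop much.
* *Coarsely connected characters `φ ≠ 0` are nonzero on edge groups*
  (`IsMaximalTree.res_edgeHom_ne_zero`). As `Γ` is reduced and not an ascending HNN-extension, each
  of the two half-spaces bounded by an edge `e` contains a translate of the other, so `φ` is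
  unbounded above on both. If `φ` vanished on `G_e`, a path from one to the other would have
  to cross at height zero.
* *Conversely* (`IsMaximalTree.coarselyConnected_of_res`), inside `{φ ≥ 0}` one gets from a coset
  of a vertex group to a neighbouring one by moving up along the edge group, and the pieces of
  the cosets in `{φ ≥ 0}` are coarsely connected.
-/

namespace BNS

/-! ### Coarse connectivity of superlevel sets -/

section Coarse

variable {G : Type*} [Group G]

/-- The value of a character at a group element, in multiplicative notation. -/
def Character.val (φ : Character G) (g : G) : ℝ := φ (Additive.ofMul g)

namespace Character

variable (φ : Character G)

@[simp] lemma val_one : φ.val 1 = 0 := map_zero φ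

@[simp] lemma val_mul (g h : G) : φ.val (g * h) = φ.val g + φ.val h :=
  map_add φ (Additive.ofMul g) (Additive.ofMul h)

@[simp] lemma val_inv (g : G) : φ.val g⁻¹ = -φ.val g := map_neg φ (Additive.ofMul g)

@[simp] lemma val_pow (g : G) (n : ℕ) : φ.val (g ^ n) = n * φ.val g := by
  induction n with
  | zero => simp
  | succ n ih => rw [pow_succ, val_mul, ih]; push_cast; ring

@[simp] lemma val_zero (g : G) : (0 : Character G).val g = 0 := rfl

@[simp] lemma val_res {H : Type*} [Group H] (f : H →* G) (h : H) :
    (φ.res f).val h = φ.val (f h) := rfl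

lemma ext_val {φ ψ : Character G} (h : ∀ g, φ.val g = ψ.val g) : φ = ψ :=
  DFunLike.ext _ _ h

lemma exists_val_pos {φ : Character G} (h : φ ≠ 0) : ∃ g, 0 < φ.val g := by
  by_contra! hle
  refine h (ext_val fun g => le_antisymm (hle g) ?_)
  simpa using hle g⁻¹

lemma exists_val_ge {φ : Character G} (h : φ ≠ 0) (M : ℝ) : ∃ g, M ≤ φ.val g := by
  obtain ⟨g, hg⟩ := exists_val_pos h
  obtain ⟨n, hn⟩ := exists_nat_ge (M / φ.val g)
  exact ⟨g ^ n, by rw [val_pow]; exact (div_le_iff₀ hg).1 hn⟩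

end Character

/-- `g` and `h` are joined by an edge of the Cayley graph with respect to `S` (or agree) and both
lie in the superlevel set `{φ ≥ c}`. -/
def SuperStep (S : Set G) (φ : Character G) (c : ℝ) (g h : G) : Prop :=
  c ≤ φ.val g ∧ c ≤ φ.val h ∧ ∃ s ∈ S, h = g * s ∨ g = h * s

/-- `g` and `h` are joined by a path of `S`-edges inside the superlevel set `{φ ≥ c}`. The constant
path is allowed even outside the superlevel set. -/
def Linked (S : Set G) (φ : Character G) (c : ℝ) : G → G → Prop :=
  Relation.ReflTransGen (SuperStep S φ c)

namespace Linked

variable {S S' : Set G} {φ : Character G} {c c' : ℝ} {g h k : G}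

lemma symm (p : Linked S φ c g h) : Linked S φ c h g :=
  have : Std.Symm (SuperStep S φ c) :=
    ⟨fun _ _ ⟨h1, h2, s, hs, h3⟩ => ⟨h2, h1, s, hs, h3.symm⟩⟩
  Relation.ReflTransGen.stdSymm.symm _ _ p

lemma trans (p : Linked S φ c g h) (q : Linked S φ c h k) : Linked S φ c g k :=
  Relation.ReflTransGen.trans p q

lemma mono (p : Linked S φ c g h) (hS : S ⊆ S') (hc : c' ≤ c) : Linked S' φ c' g h := by
  refine Relation.ReflTransGen.mono ?_ _ _ p
  rintro _ _ ⟨h1, h2, s, hs, h3⟩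
  exact ⟨hc.trans h1, hc.trans h2, s, hS hs, h3⟩

lemma step {s : G} (hs : s ∈ S) (h1 : c ≤ φ.val g) (h2 : c ≤ φ.val (g * s)) :
    Linked S φ c g (g * s) :=
  Relation.ReflTransGen.single ⟨h1, h2, s, hs, Or.inl rfl⟩

lemma translate (k : G) (p : Linked S φ c g h) :
    Linked S φ (φ.val k + c) (k * g) (k * h) := by
  refine Relation.ReflTransGen.lift (k * ·) ?_ _ _ p
  rintro a b ⟨h1, h2, s, hs, h3⟩
  refine ⟨by rw [φ.val_mul]; linarith, by rw [φ.val_mul]; linarith, s, hs, ?_⟩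
  rcases h3 with rfl | rfl <;> simp [mul_assoc]

/-- Paths are pushed forward by homomorphisms. -/
lemma map {H : Type*} [Group H] (f : H →* G) {A : Set H} (hA : ∀ a ∈ A, f a ∈ S) {x y : H}
    (p : Linked A (φ.res f) c x y) : Linked S φ c (f x) (f y) := by
  refine Relation.ReflTransGen.lift f ?_ _ _ p
  rintro a b ⟨h1, h2, s, hs, h3⟩
  exact ⟨h1, h2, f s, hA s hs, by rcases h3 with rfl | rfl <;> simp⟩

lemma mem_closure (p : Linked S φ c 1 g) : g ∈ Subgroup.closure S := by
  induction p with
  | refl => exact one_mem _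
  | tail _ hstep ih =>
    obtain ⟨-, -, s, hs, rfl | rfl⟩ := hstep
    · exact mul_mem ih (Subgroup.subset_closure hs)
    · exact (Subgroup.mul_mem_cancel_right _ (Subgroup.subset_closure hs)).1 ih

end Linked

/-- For some finite `S ⊆ G`, any two elements of `G` are joined by a path of `S`-edges
along which `φ` drops by at most a constant below the smaller of its two end values. The character
is allowed to be zero. -/
def CoarselyConnected (φ : Character G) : Prop :=
  ∃ S : Set G, S.Finite ∧ ∃ D : ℝ, 0 ≤ D ∧
    ∀ g h, ∀ c ≤ φ.val g, c ≤ φ.val h → Linked S φ (c - D) g h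

lemma coarselyConnected_of_one {φ : Character G} {S : Set G} (hS : S.Finite) {D : ℝ}
    (h : ∀ g, 0 ≤ φ.val g → Linked S φ (-D) 1 g) : CoarselyConnected φ := by
  have key : ∀ g k, φ.val g ≤ φ.val k → Linked S φ (φ.val g - D) g k := by
    intro g k hgk
    have := (h (g⁻¹ * k) (by simpa using hgk)).translate g
    simpa [sub_eq_add_neg] using this
  refine ⟨S, hS, max D 0, le_max_right _ _, fun g k c hg hk => ?_⟩
  have hD := le_max_left D 0
  rcases le_total (φ.val g) (φ.val k) with hgk | hgk
  · exact (key g k hgk).mono subset_rfl (by linarith)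
  · exact (key k g hgk).symm.mono subset_rfl (by linarith)

lemma CoarselyConnected.fg {φ : Character G} (h : CoarselyConnected φ) : Group.FG G := by
  obtain ⟨S, hS, D, -, hD⟩ := h
  refine Group.fg_iff.2 ⟨S, ?_, hS⟩
  refine eq_top_iff.2 fun g _ => (hD 1 g (min 0 (φ.val g)) ?_ (min_le_right _ _)).mem_closure
  simp

/-- For the zero character, coarse connectivity is finite generation. -/
theorem coarselyConnected_zero_iff : CoarselyConnected (0 : Character G) ↔ Group.FG G := by
  refine ⟨fun h => h.fg, fun h => ?_⟩
  obtain ⟨S, hS, hf⟩ := Group.fg_iff.1 h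
  have key : ∀ g ∈ Subgroup.closure S, ∀ k, Linked S (0 : Character G) (-0) k (k * g) := by
    intro g hg
    induction hg using Subgroup.closure_induction with
    | mem s hs => exact fun k => Linked.step hs (by simp) (by simp)
    | one => intro k; rw [mul_one]; exact Relation.ReflTransGen.refl
    | mul x y _ _ hx hy => intro k; rw [← mul_assoc]; exact (hx k).trans (hy _)
    | inv x _ hx => intro k; simpa using (hx (k * x⁻¹)).symm
  exact coarselyConnected_of_one hf (D := 0) fun g _ => by simpa using key g (hS ▸ Subgroup.mem_top g) 1

/-- For a nonzero character, coarse connectivity means that its class lies in `Σ(G)`. A path that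
drops by at most `D` is lifted into `{φ ≥ 0}` by conjugating with a power of an element on which
`φ` is positive. -/
theorem cls_mem_bnsInvariant_iff (φ : Character G) (hφ : φ ≠ 0) :
    cls φ hφ ∈ bnsInvariant G ↔ CoarselyConnected φ := by
  constructor
  · rintro ⟨ψ, hψ, he, S, hS, -, hconn⟩
    obtain ⟨a, b, ha, hb, hab⟩ := ((ray_eq_iff hψ hφ).1 he).exists_pos hψ hφ
    have hval : ∀ g, a * ψ.val g = b * φ.val g := fun g =>
      DFunLike.congr_fun hab (Additive.ofMul g)
    have hsign : ∀ g, 0 ≤ ψ.val g ↔ 0 ≤ φ.val g := fun g => by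
      rw [← mul_nonneg_iff_of_pos_left ha, hval, mul_nonneg_iff_of_pos_left hb]
    refine coarselyConnected_of_one hS (D := 0) fun g hg => ?_
    obtain ⟨w⟩ := hconn.preconnected ⟨1, ψ.val_one.ge⟩ ⟨g, (hsign g).2 hg⟩
    have key : ∀ (x y : {g : G // 0 ≤ ψ (Additive.ofMul g)}) (_ : (nonnegCayley S ψ).Walk x y),
        Linked S φ (-0) x.1 y.1 := by
      intro x y w
      induction w with
      | nil => exact Relation.ReflTransGen.refl
      | @cons u v _ hadj _ ih =>
        refine Relation.ReflTransGen.head ?_ ih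
        obtain ⟨-, s, hs, h⟩ := (SimpleGraph.mulCayley_adj' S u.1 v.1).1 hadj
        rw [neg_zero]
        exact ⟨(hsign _).1 u.2, (hsign _).1 v.2, s, hs, h.imp Eq.symm id⟩
    exact key _ _ w
  · intro h
    obtain ⟨S₀, hS₀, D, hD0, hD⟩ := id h
    obtain ⟨t, ht⟩ := Character.exists_val_ge hφ D
    have ht0 : 0 ≤ φ.val t := hD0.trans ht
    set S := insert t S₀ with hSdef
    have hconn : ∀ g, 0 ≤ φ.val g → Linked S φ 0 1 g := by
      intro g hg
      have h1 : ∀ k, 0 ≤ φ.val k → Linked S φ 0 k (k * t) := fun k hk =>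
        Linked.step (Set.mem_insert _ _) hk (by rw [φ.val_mul]; linarith)
      have h2 : Linked S φ 0 t (g * t) :=
        (hD t (g * t) (φ.val t) le_rfl (by rw [φ.val_mul]; linarith)).mono
          (Set.subset_insert _ _) (by linarith)
      have h0 := h1 1 (by simp)
      rw [one_mul] at h0
      exact (h0.trans h2).trans (h1 g hg).symm
    refine ⟨φ, hφ, rfl, S, hS₀.insert t, ?_, ?_⟩
    · refine eq_top_iff.2 fun g _ => ?_
      rcases le_total 0 (φ.val g) with hg | hg
      · exact (hconn g hg).mem_closure
      · rw [← inv_mem_iff]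
        exact (hconn g⁻¹ (by simpa using hg)).mem_closure
    · have key : ∀ x y : G, Linked S φ 0 x y → ∀ (hx : 0 ≤ φ.val x) (hy : 0 ≤ φ.val y),
          (nonnegCayley S φ).Reachable ⟨x, hx⟩ ⟨y, hy⟩ := by
        intro x y p hx
        induction p with
        | refl => exact fun _ => SimpleGraph.Reachable.refl _
        | @tail y z _ hstep ih =>
          intro hz
          obtain ⟨hy, -, s, hs, h⟩ := hstep
          refine (ih hy).trans ?_
          by_cases hyz : y = z
          · subst hyz; exact SimpleGraph.Reachable.refl _
          · exact SimpleGraph.Adj.reachable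
              ((SimpleGraph.mulCayley_adj' S y z).2 ⟨hyz, s, hs, h.imp Eq.symm id⟩)
      have : Nonempty {g : G // 0 ≤ φ (Additive.ofMul g)} := ⟨⟨1, φ.val_one.ge⟩⟩
      exact ⟨fun x y =>
        key x.1 y.1 ((hconn x.1 x.2).symm.trans (hconn y.1 y.2)) x.2 y.2⟩

lemma InVarsigma.coarselyConnected (h : InVarsigma G) (φ : Character G) :
    CoarselyConnected φ := by
  by_cases hφ : φ = 0
  · subst hφ; exact coarselyConnected_zero_iff.2 h.1
  · exact (cls_mem_bnsInvariant_iff φ hφ).1 (h.2 ▸ Set.mem_univ _)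

end Coarse

namespace GraphOfGroups

/-! ### Potentials on a maximal tree -/

section Potential

variable {V E : Type*} {Γ : GraphOfGroups V E} {T : Set E}

lemma IsMaximalTree.adj (hT : Γ.IsMaximalTree T) {e : E} (he : e ∈ T) :
    (Γ.spanningGraph T).Adj (Γ.src e) (Γ.tgt e) :=
  (SimpleGraph.fromRel_adj _ _ _).2 ⟨hT.no_loops e he, Or.inl ⟨e, he, rfl, rfl⟩⟩

lemma spanningGraph_adj {v w : V} (h : (Γ.spanningGraph T).Adj v w) :
    ∃ e ∈ T, (Γ.src e = v ∧ Γ.tgt e = w) ∨ (Γ.src e = w ∧ Γ.tgt e = v) := by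
  obtain ⟨-, ⟨e, he, h⟩ | ⟨e, he, h⟩⟩ := (SimpleGraph.fromRel_adj _ _ _).1 h
  exacts [⟨e, he, Or.inl h⟩, ⟨e, he, Or.inr h⟩]

/-- Every group-valued function on the edges of a maximal tree is the coboundary of a
function on the vertices: the value at `v` is the product along the path from a root to `v`. -/
theorem IsMaximalTree.exists_potential (hT : Γ.IsMaximalTree T) {K : Type*} [Group K]
    (τ : E → K) : ∃ γ : V → K, ∀ e ∈ T, γ (Γ.src e) * τ e = γ (Γ.tgt e) := by
  classical
  let wt : V → V → K := fun v w =>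
    if h : ∃ e ∈ T, Γ.src e = v ∧ Γ.tgt e = w then τ h.choose
    else if h : ∃ e ∈ T, Γ.src e = w ∧ Γ.tgt e = v then (τ h.choose)⁻¹ else 1
  have wt_fwd : ∀ e ∈ T, wt (Γ.src e) (Γ.tgt e) = τ e := by
    intro e he
    have h : ∃ e' ∈ T, Γ.src e' = Γ.src e ∧ Γ.tgt e' = Γ.tgt e := ⟨e, he, rfl, rfl⟩
    obtain ⟨h1, h2, h3⟩ := h.choose_spec
    simp only [wt, dif_pos h]
    rw [hT.no_multiple _ h1 e he (by rw [h2, h3])]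
  have wt_bwd : ∀ e ∈ T, wt (Γ.tgt e) (Γ.src e) = (τ e)⁻¹ := by
    intro e he
    have h' : ¬ ∃ e' ∈ T, Γ.src e' = Γ.tgt e ∧ Γ.tgt e' = Γ.src e := by
      rintro ⟨e', he', h1, h2⟩
      have := hT.no_multiple e' he' e he (by rw [h1, h2, Sym2.eq_swap])
      subst this
      exact hT.no_loops _ he h1
    have h : ∃ e' ∈ T, Γ.src e' = Γ.src e ∧ Γ.tgt e' = Γ.tgt e := ⟨e, he, rfl, rfl⟩
    obtain ⟨h1, h2, h3⟩ := h.choose_spec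
    simp only [wt, dif_neg h', dif_pos h]
    rw [hT.no_multiple _ h1 e he (by rw [h2, h3])]
  let prod : ∀ {v w : V}, (Γ.spanningGraph T).Walk v w → K := fun p =>
    (p.darts.map fun d => wt d.fst d.snd).prod
  have prod_concat : ∀ {u v w : V} (p : (Γ.spanningGraph T).Walk u v)
      (h : (Γ.spanningGraph T).Adj v w), prod (p.concat h) = prod p * wt v w := by
    intro u v w p h
    simp [prod, SimpleGraph.Walk.darts_concat]
  obtain ⟨r⟩ := hT.isTree.connected.nonempty
  choose p hp hpu using fun v => hT.isTree.existsUnique_path r v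
  refine ⟨fun v => prod (p v), fun e he => ?_⟩
  have hadj := hT.adj he
  by_cases hs : Γ.src e ∈ (p (Γ.tgt e)).support
  · have := hT.isTree.isAcyclic.path_concat (hp _) (hp _) hadj hs
    simp only
    rw [this, prod_concat, wt_fwd e he]
  · have hm := hT.isTree.isAcyclic.mem_support_of_ne_mem_support_of_adj_of_isPath
      (hp _) (hp _) hadj hs
    have := hT.isTree.isAcyclic.path_concat (hp _) (hp _) hadj.symm hm
    simp only
    rw [this, prod_concat, wt_bwd e he, inv_mul_cancel_right]

end Potential

/-! ### The fundamental group: stable letters, universal property, embedded vertex groups -/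

section FundGroup

variable {V E : Type*} (Γ : GraphOfGroups V E) (T : Set E)

/-- The stable letter `t_e` in the fundamental group. -/
def stable (e : E) : Γ.FundGroup T := QuotientGroup.mk' _ (Γ.preStable e)

variable {T}

lemma stable_eq_one {e : E} (he : e ∈ T) : Γ.stable T e = 1 :=
  (QuotientGroup.eq_one_iff _).2 (Subgroup.subset_normalClosure (Or.inr ⟨e, he, rfl⟩))

variable (T)

lemma stable_conj (e : E) (a : Γ.EGroup e) :
    (Γ.stable T e)⁻¹ * Γ.edgeHom T e a * Γ.stable T e =
      Γ.vertexHom T (Γ.tgt e) (Γ.tgtHom e a) := by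
  have h : (QuotientGroup.mk' (Subgroup.normalClosure (Γ.relators T)))
      ((Γ.preStable e)⁻¹ * Γ.preVertex (Γ.src e) (Γ.srcHom e a) * Γ.preStable e *
        (Γ.preVertex (Γ.tgt e) (Γ.tgtHom e a))⁻¹) = 1 :=
    (QuotientGroup.eq_one_iff _).2 (Subgroup.subset_normalClosure (Or.inl ⟨e, a, rfl⟩))
  rw [map_mul, map_inv, mul_inv_eq_one] at h
  exact h

lemma edgeHom_mul_stable (e : E) (a : Γ.EGroup e) :
    Γ.edgeHom T e a * Γ.stable T e =
      Γ.stable T e * Γ.vertexHom T (Γ.tgt e) (Γ.tgtHom e a) := by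
  rw [← stable_conj]; group

/-- Induction on elements of the fundamental group, from vertex groups and stable letters. -/
lemma fundGroup_induction {P : Γ.FundGroup T → Prop}
    (vertex : ∀ v a, P (Γ.vertexHom T v a)) (stable : ∀ e, P (Γ.stable T e))
    (one : P 1) (mul : ∀ x y, P x → P y → P (x * y)) (inv : ∀ x, P x → P x⁻¹)
    (g : Γ.FundGroup T) : P g := by
  obtain ⟨x, rfl⟩ := QuotientGroup.mk'_surjective _ g
  induction x using Monoid.Coprod.induction_on with
  | inl m =>
    induction m using Monoid.CoprodI.induction_on with
    | one => rw [map_one, map_one]; exact one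
    | of v a => exact vertex v a
    | mul x y hx hy => rw [map_mul, map_mul]; exact mul _ _ hx hy
  | inr n =>
    induction n using FreeGroup.induction_on with
    | C1 => rw [map_one, map_one]; exact one
    | of e => exact stable e
    | inv_of e _ => rw [map_inv, map_inv]; exact inv _ (stable e)
    | mul x y hx hy => rw [map_mul, map_mul]; exact mul _ _ hx hy
  | mul x y hx hy => rw [map_mul]; exact mul _ _ hx hy

variable {Γ T}

/-- Homomorphisms `α v : G_v → K` and elements `τ e ∈ K` that satisfy the edge relations
define a homomorphism on the fundamental group even when `τ e ≠ 1` for edges of `T`, up to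
conjugating by a potential `γ` of `τ` along `T`. -/
theorem IsMaximalTree.exists_lift (hT : Γ.IsMaximalTree T) {K : Type*} [Group K]
    (α : ∀ v, Γ.VGroup v →* K) (τ : E → K)
    (hrel : ∀ e a, (τ e)⁻¹ * α _ (Γ.srcHom e a) * τ e = α _ (Γ.tgtHom e a)) :
    ∃ (Φ : Γ.FundGroup T →* K) (γ : V → K),
      (∀ v a, Φ (Γ.vertexHom T v a) = γ v * α v a * (γ v)⁻¹) ∧
      ∀ e, Φ (Γ.stable T e) = γ (Γ.src e) * τ e * (γ (Γ.tgt e))⁻¹ := by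
  obtain ⟨γ, hγ⟩ := hT.exists_potential τ
  let Ψ : Γ.FreeProd →* K := Monoid.Coprod.lift
    (Monoid.CoprodI.lift fun v => (MulAut.conj (γ v)).toMonoidHom.comp (α v))
    (FreeGroup.lift fun e => γ (Γ.src e) * τ e * (γ (Γ.tgt e))⁻¹)
  have hv : ∀ v a, Ψ (Γ.preVertex v a) = γ v * α v a * (γ v)⁻¹ := fun v a => by
    simp [Ψ, preVertex]
  have hs : ∀ e, Ψ (Γ.preStable e) = γ (Γ.src e) * τ e * (γ (Γ.tgt e))⁻¹ := fun e => by
    simp [Ψ, preStable]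
  have hker : Subgroup.normalClosure (Γ.relators T) ≤ Ψ.ker := by
    refine Subgroup.normalClosure_le_normal ?_
    rintro _ (⟨e, a, rfl⟩ | ⟨e, he, rfl⟩)
    · change Ψ _ = 1
      simp only [map_mul, map_inv, hv, hs, ← hrel]
      group
    · change Ψ _ = 1
      rw [hs, hγ e he, mul_inv_cancel]
  exact ⟨QuotientGroup.lift _ Ψ hker, γ, hv, hs⟩

/-- Over the vertex groups, stable letters for finitely many edges can be adjoined with
the vertex groups remaining embedded, by iterating HNN-extensions. -/
theorem exists_embedding.{u₁, u₂, u₃, u₄} {V : Type u₁} {E : Type u₂}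
    (Γ : GraphOfGroups.{u₁, u₂, u₃, u₄} V E) (s : Finset E) :
    ∃ (K : Type (max u₁ u₃)) (_ : Group K) (α : ∀ v, Γ.VGroup v →* K) (τ : E → K),
      (∀ v, Function.Injective (α v)) ∧
      ∀ e ∈ s, ∀ a, (τ e)⁻¹ * α _ (Γ.srcHom e a) * τ e = α _ (Γ.tgtHom e a) := by
  classical
  induction s using Finset.induction_on with
  | empty =>
    exact ⟨Monoid.CoprodI Γ.VGroup, inferInstance, fun v => Monoid.CoprodI.of, fun _ => 1,
      fun v => Monoid.CoprodI.of_injective v, by simp⟩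
  | insert e s he ih =>
    obtain ⟨K, _, α, τ, hα, hrel⟩ := ih
    let i : Γ.EGroup e →* K := (α (Γ.src e)).comp (Γ.srcHom e)
    let j : Γ.EGroup e →* K := (α (Γ.tgt e)).comp (Γ.tgtHom e)
    have hi : Function.Injective i := (hα _).comp (Γ.srcHom_injective e)
    have hj : Function.Injective j := (hα _).comp (Γ.tgtHom_injective e)
    let θ : i.range ≃* j.range := (i.ofInjective hi).symm.trans (j.ofInjective hj)
    have hθ : ∀ a, θ ⟨i a, a, rfl⟩ = ⟨j a, a, rfl⟩ := by
      intro a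
      have : (⟨i a, a, rfl⟩ : i.range) = i.ofInjective hi a := rfl
      rw [this]
      simp only [θ, MulEquiv.trans_apply, MulEquiv.symm_apply_apply]
      rfl
    refine ⟨HNNExtension K i.range j.range θ, inferInstance,
      fun v => HNNExtension.of.comp (α v),
      fun f => if f = e then HNNExtension.t⁻¹ else HNNExtension.of (τ f),
      fun v => (HNNExtension.of_injective _).comp (hα v), fun f hf a => ?_⟩
    by_cases hfe : f = e
    · subst hfe
      have h := HNNExtension.equiv_eq_conj (φ := θ) ⟨i a, a, rfl⟩
      rw [hθ] at h
      simp only [if_true, inv_inv]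
      exact h.symm
    · simp only [if_neg hfe, MonoidHom.comp_apply,
        ← hrel f ((Finset.mem_insert.1 hf).resolve_left hfe) a, map_mul, map_inv]

/-- The vertex groups embed into the fundamental group. -/
theorem IsMaximalTree.vertexHom_injective [Finite E] (hT : Γ.IsMaximalTree T) (v : V) :
    Function.Injective (Γ.vertexHom T v) := by
  have : Fintype E := Fintype.ofFinite E
  obtain ⟨K, _, α, τ, hα, hrel⟩ := exists_embedding Γ Finset.univ
  obtain ⟨Φ, γ, hv, -⟩ := hT.exists_lift α τ fun e => hrel e (Finset.mem_univ e)
  intro a b hab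
  have := congrArg Φ hab
  rw [hv, hv] at this
  exact hα v (mul_left_cancel (mul_right_cancel this))

end FundGroup

variable {V E : Type*} {Γ : GraphOfGroups V E} {T : Set E}

/-! ### Paths in the blown-up Bass-Serre tree -/

/-- Elementary moves on `π₁(Γ, T) × V`, where `(g, w)` stands for the element `g` of the coset
`g G_w`: multiplication by an element of `G_w` (taken from the family `F`), and passage along the
edge `g e` from the coset `g G_{src e}` to the coset `g t_e G_{tgt e}`. Collapsing the cosets
yields the Bass-Serre tree. -/
inductive Move (Γ : GraphOfGroups V E) (T : Set E) (F : Set (Σ v, Γ.VGroup v)) :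
    Γ.FundGroup T × V → Γ.FundGroup T × V → Prop
  | vertex (g : Γ.FundGroup T) (w : V) (a : Γ.VGroup w) (ha : ⟨w, a⟩ ∈ F) :
      Move Γ T F (g, w) (g * Γ.vertexHom T w a, w)
  | edge (g : Γ.FundGroup T) (f : E) :
      Move Γ T F (g, Γ.src f) (g * Γ.stable T f, Γ.tgt f)

/-- `x` and `y` are related by a move in one of the two directions. -/
def Adjacent (Γ : GraphOfGroups V E) (T : Set E) (F : Set (Σ v, Γ.VGroup v))
    (x y : Γ.FundGroup T × V) : Prop :=
  Γ.Move T F x y ∨ Γ.Move T F y x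

/-- `x` and `y` are joined by a path of moves on which `φ ≥ c`. -/
def Joined (F : Set (Σ v, Γ.VGroup v)) (φ : Character (Γ.FundGroup T)) (c : ℝ) :
    Γ.FundGroup T × V → Γ.FundGroup T × V → Prop :=
  Relation.ReflTransGen fun x y => c ≤ φ.val x.1 ∧ c ≤ φ.val y.1 ∧ Γ.Adjacent T F x y

variable {F F' : Set (Σ v, Γ.VGroup v)} {φ : Character (Γ.FundGroup T)} {c c' : ℝ}
  {x y z : Γ.FundGroup T × V}

lemma Move.mono (h : Γ.Move T F x y) (hF : F ⊆ F') : Γ.Move T F' x y := by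
  cases h with
  | vertex g w a ha => exact .vertex g w a (hF ha)
  | edge g f => exact .edge g f

lemma Move.translate (k : Γ.FundGroup T) (h : Γ.Move T F x y) :
    Γ.Move T F (k * x.1, x.2) (k * y.1, y.2) := by
  cases h with
  | vertex g w a ha => simpa [mul_assoc] using Move.vertex (k * g) w a ha
  | edge g f => simpa [mul_assoc] using Move.edge (F := F) (k * g) f

lemma Adjacent.mono (h : Γ.Adjacent T F x y) (hF : F ⊆ F') : Γ.Adjacent T F' x y :=
  h.imp (·.mono hF) (·.mono hF)

lemma Adjacent.translate (k : Γ.FundGroup T) (h : Γ.Adjacent T F x y) :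
    Γ.Adjacent T F (k * x.1, x.2) (k * y.1, y.2) :=
  h.imp (·.translate k) (·.translate k)

namespace Joined

lemma symm (p : Joined F φ c x y) : Joined F φ c y x :=
  have : Std.Symm fun x y : Γ.FundGroup T × V =>
      c ≤ φ.val x.1 ∧ c ≤ φ.val y.1 ∧ Γ.Adjacent T F x y :=
    ⟨fun _ _ ⟨h1, h2, h3⟩ => ⟨h2, h1, h3.symm⟩⟩
  Relation.ReflTransGen.stdSymm.symm _ _ p

lemma trans (p : Joined F φ c x y) (q : Joined F φ c y z) : Joined F φ c x z :=
  Relation.ReflTransGen.trans p q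

lemma mono (p : Joined F φ c x y) (hF : F ⊆ F') (hc : c' ≤ c) : Joined F' φ c' x y := by
  refine Relation.ReflTransGen.mono ?_ _ _ p
  rintro _ _ ⟨h1, h2, h3⟩
  exact ⟨hc.trans h1, hc.trans h2, h3.mono hF⟩

lemma translate (k : Γ.FundGroup T) (p : Joined F φ c x y) :
    Joined F φ (φ.val k + c) (k * x.1, x.2) (k * y.1, y.2) := by
  refine Relation.ReflTransGen.lift
    (fun x : Γ.FundGroup T × V => (k * x.1, x.2)) ?_ _ _ p
  rintro a b ⟨h1, h2, h3⟩
  exact ⟨by simp only [φ.val_mul]; linarith, by simp only [φ.val_mul]; linarith,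
    h3.translate k⟩

end Joined

/-- Any two points are joined by a path; a path uses only finitely many elements of
vertex groups and is bounded below. -/
theorem IsMaximalTree.exists_joined (hT : Γ.IsMaximalTree T) (φ : Character (Γ.FundGroup T))
    (x y : Γ.FundGroup T × V) :
    ∃ F : Set (Σ v, Γ.VGroup v), F.Finite ∧ ∃ c : ℝ, Joined F φ c x y := by
  let Q : Γ.FundGroup T × V → Γ.FundGroup T × V → Prop := fun x y =>
    ∃ F : Set (Σ v, Γ.VGroup v), F.Finite ∧ ∃ c : ℝ, Joined F φ c x y
  have Qsymm : ∀ {x y}, Q x y → Q y x := fun ⟨F, hF, c, h⟩ => ⟨F, hF, c, h.symm⟩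
  have Qtrans : ∀ {x y z}, Q x y → Q y z → Q x z := by
    rintro x y z ⟨F, hF, c, h⟩ ⟨F', hF', c', h'⟩
    exact ⟨F ∪ F', hF.union hF', min c c',
      (h.mono Set.subset_union_left (min_le_left _ _)).trans
        (h'.mono Set.subset_union_right (min_le_right _ _))⟩
  have Qmove : ∀ {F x y}, F.Finite → Γ.Move T F x y → Q x y := fun {F x y} hF h =>
    ⟨F, hF, min (φ.val x.1) (φ.val y.1),
      Relation.ReflTransGen.single ⟨min_le_left _ _, min_le_right _ _, Or.inl h⟩⟩
  have Qtree : ∀ g w w', Q (g, w) (g, w') := by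
    intro g w w'
    obtain ⟨p⟩ := hT.isTree.connected.preconnected w w'
    induction p with
    | nil => exact ⟨∅, Set.finite_empty, 0, Relation.ReflTransGen.refl⟩
    | cons hadj _ ih =>
      refine Qtrans ?_ ih
      obtain ⟨e, he, ⟨rfl, rfl⟩ | ⟨rfl, rfl⟩⟩ := spanningGraph_adj hadj
      · simpa [Γ.stable_eq_one he] using Qmove Set.finite_empty (Move.edge g e)
      · exact Qsymm (by simpa [Γ.stable_eq_one he] using Qmove Set.finite_empty (Move.edge g e))
  have key : ∀ k g w w', Q (g, w) (g * k, w') := by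
    intro k
    induction k using fundGroup_induction with
    | vertex v a =>
      exact fun g w w' => Qtrans (Qtree g w v)
        (Qtrans (Qmove (Set.finite_singleton ⟨v, a⟩) (Move.vertex g v a rfl)) (Qtree _ v w'))
    | stable e =>
      exact fun g w w' => Qtrans (Qtree g w (Γ.src e))
        (Qtrans (Qmove Set.finite_empty (Move.edge g e)) (Qtree _ (Γ.tgt e) w'))
    | one => intro g w w'; rw [mul_one]; exact Qtree g w w'
    | mul k l hk hl =>
      intro g w w'; rw [← mul_assoc]; exact Qtrans (hk g w w) (hl _ w w')
    | inv k hk =>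
      intro g w w'
      have := Qsymm (hk (g * k⁻¹) w' w)
      rwa [inv_mul_cancel_right] at this
  have := key (x.1⁻¹ * y.1) x.1 x.2 y.2
  rwa [mul_inv_cancel_left] at this

/-- A property of points that is preserved by moves and holds at one point holds everywhere. -/
theorem IsMaximalTree.move_induction (hT : Γ.IsMaximalTree T) {P : Γ.FundGroup T → V → Prop}
    {g₀ : Γ.FundGroup T} {v₀ : V} (base : P g₀ v₀)
    (vertex : ∀ g w a, P g w → P (g * Γ.vertexHom T w a) w)
    (edge : ∀ g f, P g (Γ.src f) ↔ P (g * Γ.stable T f) (Γ.tgt f))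
    (g : Γ.FundGroup T) (w : V) : P g w := by
  obtain ⟨F, -, c, p⟩ := hT.exists_joined 0 (g₀, v₀) (g, w)
  suffices ∀ x, Joined F 0 c (g₀, v₀) x → P x.1 x.2 from this _ p
  intro x p
  induction p with
  | refl => exact base
  | tail _ h ih =>
    obtain ⟨-, -, h | h⟩ := h
    · cases h with
      | vertex g w a _ => exact vertex g w a ih
      | edge g f => exact (edge g f).1 ih
    · cases h with
      | vertex g w a _ => simpa using vertex _ w a⁻¹ ih
      | edge g f => exact (edge g f).2 ih

/-- A coarsely connected character of the fundamental group has finitely many elements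
of vertex groups that suffice for paths losing only a bounded amount of height. -/
theorem IsMaximalTree.exists_joined_of_coarselyConnected (hT : Γ.IsMaximalTree T)
    (hφ : CoarselyConnected φ) (v : V) :
    ∃ F : Set (Σ v, Γ.VGroup v), F.Finite ∧ ∃ D : ℝ,
      ∀ g h, ∀ c ≤ φ.val g, c ≤ φ.val h → Joined F φ (c - D) (g, v) (h, v) := by
  obtain ⟨S, hS, D, -, hD⟩ := hφ
  have hgen : ∃ F : Set (Σ v, Γ.VGroup v), F.Finite ∧ ∃ d : ℝ,
      ∀ s ∈ S, Joined F φ d (1, v) (s, v) := by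
    clear hD
    induction S, hS using Set.Finite.induction_on with
    | empty => exact ⟨∅, Set.finite_empty, 0, by simp⟩
    | @insert s S _ _ ih =>
      obtain ⟨F, hF, d, h⟩ := ih
      obtain ⟨F', hF', d', h'⟩ := hT.exists_joined φ (1, v) (s, v)
      refine ⟨F ∪ F', hF.union hF', min d d', ?_⟩
      rintro t (rfl | ht)
      · exact h'.mono Set.subset_union_right (min_le_right _ _)
      · exact (h t ht).mono Set.subset_union_left (min_le_left _ _)
  obtain ⟨F, hF, d, hd⟩ := hgen
  refine ⟨F, hF, D - d, fun g h c hg hh => ?_⟩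
  have hstep : ∀ k s, s ∈ S → c - D ≤ φ.val k →
      Joined F φ (c - (D - d)) (k, v) (k * s, v) := by
    intro k s hs hk
    have := (hd s hs).translate k
    simp only [mul_one] at this
    exact this.mono subset_rfl (by linarith)
  have p := hD g h c hg hh
  clear hg hh
  induction p with
  | refl => exact Relation.ReflTransGen.refl
  | tail _ h ih =>
    obtain ⟨h1, h2, s, hs, rfl | rfl⟩ := h
    · exact ih.trans (hstep _ s hs h1)
    · exact ih.trans (hstep _ s hs h2).symm

/-! ### Half-spaces -/

/-- `H` is the half-space of the Bass-Serre tree beyond the edge `e`: it is a union of cosets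
`g G_w`, contains the far but not the near endpoint of `e`, and among all edges
`g f` only the edges `g e` with `g ∈ G_e`, which agree with `e`, join it to its complement. -/
structure IsWall (Γ : GraphOfGroups V E) (T : Set E) (e : E) (H : Set (Γ.FundGroup T × V)) :
    Prop where
  vertex : ∀ g w a, (g * Γ.vertexHom T w a, w) ∈ H ↔ (g, w) ∈ H
  edge_of_ne : ∀ g f, f ≠ e → ((g * Γ.stable T f, Γ.tgt f) ∈ H ↔ (g, Γ.src f) ∈ H)
  edge_of_notMem : ∀ g, g ∉ (Γ.edgeHom T e).range →
    ((g * Γ.stable T e, Γ.tgt e) ∈ H ↔ (g, Γ.src e) ∈ H)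
  src : (1, Γ.src e) ∉ H
  tgt : (Γ.stable T e, Γ.tgt e) ∈ H

open Classical in
/-- Every edge bounds a half-space. The group acts on `π₁(Γ, T) × ℤ` by right translation, the
integer being raised by one whenever the edge `e` itself is traversed from its origin to its
terminus; the half-space consists of the points at which this count of crossings is `1`. -/
theorem IsMaximalTree.exists_isWall (hT : Γ.IsMaximalTree T) (e : E) :
    ∃ H : Set (Γ.FundGroup T × V), Γ.IsWall T e H := by
  let G := Γ.FundGroup T
  let j : E → G → ℤ := fun f x => if f = e ∧ x ∈ (Γ.edgeHom T e).range then 1 else 0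
  have hj : ∀ f x a, j f (x * (Γ.edgeHom T f a)⁻¹) = j f x := by
    intro f x a
    by_cases hf : f = e
    · subst hf
      have : x * (Γ.edgeHom T f a)⁻¹ ∈ (Γ.edgeHom T f).range ↔ x ∈ (Γ.edgeHom T f).range :=
        Subgroup.mul_mem_cancel_right _ (inv_mem ⟨a, rfl⟩)
      simp only [j, this]
    · simp only [j, hf, false_and]
  let α : ∀ v, Γ.VGroup v →* Equiv.Perm (G × ℤ) := fun v =>
    { toFun := fun a => (Equiv.mulRight (Γ.vertexHom T v a)⁻¹).prodCongr (Equiv.refl ℤ)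
      map_one' := by ext x <;> simp
      map_mul' := fun a b => by ext x <;> simp [mul_assoc] }
  have hα : ∀ v a (p : G × ℤ), α v a p = (p.1 * (Γ.vertexHom T v a)⁻¹, p.2) :=
    fun v a p => rfl
  let σ : E → Equiv.Perm (G × ℤ) := fun f =>
    { toFun := fun p => (p.1 * Γ.stable T f, p.2 + j f p.1)
      invFun := fun p => (p.1 * (Γ.stable T f)⁻¹, p.2 - j f (p.1 * (Γ.stable T f)⁻¹))
      left_inv := fun p => by simp
      right_inv := fun p => by simp }
  have hσ : ∀ f (p : G × ℤ), σ f p = (p.1 * Γ.stable T f, p.2 + j f p.1) := fun f p => rfl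
  have hσ' : ∀ f (p : G × ℤ), (σ f)⁻¹ p =
      (p.1 * (Γ.stable T f)⁻¹, p.2 - j f (p.1 * (Γ.stable T f)⁻¹)) := fun f p => rfl
  obtain ⟨Φ, γ, hv, hs⟩ := hT.exists_lift α (fun f => (σ f)⁻¹) (by
    intro f a
    refine Equiv.ext fun p => ?_
    have hconj := Γ.stable_conj T f a
    have hja := hj f (p.1 * (Γ.stable T f)⁻¹) a
    have hedge : Γ.edgeHom T f a = Γ.vertexHom T (Γ.src f) (Γ.srcHom f a) := rfl
    rw [hedge] at hconj hja
    simp only [inv_inv, Equiv.Perm.mul_apply, hσ, hσ', hα, hja, ← hconj]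
    refine Prod.ext ?_ ?_
    · simp [mul_assoc]
    · simp)
  let p : G → V → G × ℤ := fun g w => (Φ g * γ w)⁻¹ (γ (Γ.src e) (1, 0))
  have hp0 : p 1 (Γ.src e) = (1, 0) := by
    change (Φ 1 * γ (Γ.src e))⁻¹ (γ (Γ.src e) (1, 0)) = _
    rw [map_one, one_mul, ← Equiv.Perm.mul_apply, inv_mul_cancel, Equiv.Perm.one_apply]
  have hpv : ∀ g w a, p (g * Γ.vertexHom T w a) w = ((p g w).1 * Γ.vertexHom T w a, (p g w).2) := by
    intro g w a
    have : (Φ (g * Γ.vertexHom T w a) * γ w)⁻¹ = α w a⁻¹ * (Φ g * γ w)⁻¹ := by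
      rw [map_mul, hv, map_inv]; group
    simp only [p, this, Equiv.Perm.mul_apply, hα, map_inv (Γ.vertexHom T w), inv_inv]
  have hpe : ∀ g f, p (g * Γ.stable T f) (Γ.tgt f) =
      ((p g (Γ.src f)).1 * Γ.stable T f, (p g (Γ.src f)).2 + j f (p g (Γ.src f)).1) := by
    intro g f
    have : (Φ (g * Γ.stable T f) * γ (Γ.tgt f))⁻¹ = σ f * (Φ g * γ (Γ.src f))⁻¹ := by
      rw [map_mul, hs]; group
    simp only [p, this, Equiv.Perm.mul_apply, hσ]
  have hfst : ∀ g w, (p g w).1 = g := by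
    refine hT.move_induction (g₀ := 1) (v₀ := Γ.src e) (by rw [hp0]) ?_ ?_
    · intro g w a h; rw [hpv, h]
    · intro g f; rw [hpe]; exact ⟨fun h => by rw [h], fun h => mul_right_cancel h⟩
  refine ⟨{x | (p x.1 x.2).2 = 1}, ?_, ?_, ?_, ?_, ?_⟩
  · intro g w a
    simp only [Set.mem_ofPred_eq, hpv]
  · intro g f hf
    simp [hpe, j, hf]
  · intro g hg
    simp only [Set.mem_ofPred_eq, hpe, hfst, j, hg, and_false, if_false, add_zero]
  · simp [hp0]
  · have := hpe 1 e
    rw [one_mul, hp0] at this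
    have h1 : (1 : G) ∈ (Γ.edgeHom T e).range := one_mem _
    simp [this, j, -MonoidHom.mem_range, h1]

/-- `H` is a half-space on the far side of an edge issuing from the coset `G_u`, with
stabilizer `C`: from `H`, its complement can be entered only at an element of `C`. -/
structure IsHalfSpace (Γ : GraphOfGroups V E) (T : Set E) (u : V) (C : Subgroup (Γ.VGroup u))
    (H : Set (Γ.FundGroup T × V)) : Prop where
  vertex : ∀ g w a, (g * Γ.vertexHom T w a, w) ∈ H ↔ (g, w) ∈ H
  base : (1, u) ∉ H
  exit : ∀ x ∈ H, ∀ y ∉ H, Γ.Adjacent T Set.univ x y → ∃ b ∈ C, y = (Γ.vertexHom T u b, u)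

namespace IsWall

variable {e : E} {H : Set (Γ.FundGroup T × V)}

lemma edgeHom_src (hH : Γ.IsWall T e H) (a : Γ.EGroup e) :
    (Γ.edgeHom T e a, Γ.src e) ∉ H := by
  have := hH.vertex 1 (Γ.src e) (Γ.srcHom e a)
  rw [one_mul] at this
  exact fun h => hH.src (this.1 h)

/-- The half-space beyond `e`, seen from the origin of `e`. -/
lemma isHalfSpace_src (hH : Γ.IsWall T e H) :
    Γ.IsHalfSpace T (Γ.src e) (Γ.srcHom e).range H := by
  refine ⟨hH.vertex, hH.src, ?_⟩
  rintro x hx y hy (h | h)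
  · cases h with
    | vertex g w a _ => exact absurd ((hH.vertex g w a).2 hx) hy
    | edge g f =>
      by_cases hf : f = e
      · subst hf
        by_cases hg : g ∈ (Γ.edgeHom T f).range
        · obtain ⟨a, rfl⟩ := hg
          exact absurd hx (hH.edgeHom_src a)
        · exact absurd ((hH.edge_of_notMem g hg).2 hx) hy
      · exact absurd ((hH.edge_of_ne g f hf).2 hx) hy
  · cases h with
    | vertex g w a _ => exact absurd ((hH.vertex _ w a).1 hx) hy
    | edge g f =>
      by_cases hf : f = e
      · subst hf
        by_cases hg : g ∈ (Γ.edgeHom T f).range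
        · obtain ⟨a, rfl⟩ := hg
          exact ⟨_, ⟨a, rfl⟩, rfl⟩
        · exact absurd ((hH.edge_of_notMem g hg).1 hx) hy
      · exact absurd ((hH.edge_of_ne g f hf).1 hx) hy

/-- The complementary half-space, seen from the terminus of `e` and moved
to the base point by `t_e⁻¹`. -/
lemma isHalfSpace_tgt (hH : Γ.IsWall T e H) :
    Γ.IsHalfSpace T (Γ.tgt e) (Γ.tgtHom e).range {x | (Γ.stable T e * x.1, x.2) ∉ H} := by
  refine ⟨fun g w a => ?_, ?_, ?_⟩
  · simp only [Set.mem_ofPred_eq, ← mul_assoc, hH.vertex]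
  · simpa using hH.tgt
  · intro x hx y hy h
    simp only [Set.mem_ofPred_eq, not_not] at hx hy
    have key : ∃ b ∈ (Γ.tgtHom e).range, (Γ.stable T e * y.1, y.2) =
        (Γ.stable T e * Γ.vertexHom T (Γ.tgt e) b, Γ.tgt e) := by
      replace h := h.translate (Γ.stable T e)
      generalize (Γ.stable T e * x.1, x.2) = x' at hx h
      generalize (Γ.stable T e * y.1, y.2) = y' at hy h ⊢
      obtain h | h := h
      · cases h with
        | vertex g w a _ => exact absurd ((hH.vertex _ w a).1 hy) hx
        | edge g f =>
          by_cases hf : f = e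
          · subst hf
            by_cases hg : g ∈ (Γ.edgeHom T f).range
            · obtain ⟨a, rfl⟩ := hg
              exact ⟨_, ⟨a, rfl⟩, by rw [edgeHom_mul_stable]⟩
            · exact absurd ((hH.edge_of_notMem g hg).1 hy) hx
          · exact absurd ((hH.edge_of_ne g f hf).1 hy) hx
      · cases h with
        | vertex g w a _ => exact absurd ((hH.vertex g w a).2 hy) hx
        | edge g f =>
          by_cases hf : f = e
          · subst hf
            by_cases hg : g ∈ (Γ.edgeHom T f).range
            · obtain ⟨a, rfl⟩ := hg
              exact absurd hy (hH.edgeHom_src a)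
            · exact absurd ((hH.edge_of_notMem g hg).2 hy) hx
          · exact absurd ((hH.edge_of_ne g f hf).2 hy) hx
    obtain ⟨b, hb, h⟩ := key
    obtain ⟨h1, h2⟩ := Prod.mk.inj h
    exact ⟨b, hb, Prod.ext (mul_left_cancel h1) h2⟩

end IsWall

/-! ### Vertex groups inherit coarse connectivity -/

/-- The images of the edge groups in the vertex groups, each edge contributing one subgroup at
each of its two ends. -/
inductive IsEdgeSubgroup (Γ : GraphOfGroups V E) : ∀ v, Subgroup (Γ.VGroup v) → Prop
  | src (e : E) : IsEdgeSubgroup Γ (Γ.src e) (Γ.srcHom e).range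
  | tgt (e : E) : IsEdgeSubgroup Γ (Γ.tgt e) (Γ.tgtHom e).range

lemma finite_isEdgeSubgroup [Finite E] (Γ : GraphOfGroups V E) (v : V) :
    {C | Γ.IsEdgeSubgroup v C}.Finite := by
  let f : E ⊕ E → Σ v, Subgroup (Γ.VGroup v) :=
    Sum.elim (fun e => ⟨Γ.src e, (Γ.srcHom e).range⟩) (fun e => ⟨Γ.tgt e, (Γ.tgtHom e).range⟩)
  refine ((Set.finite_range f).preimage (f := Sigma.mk v)
    sigma_mk_injective.injOn).subset fun C hC => ?_
  have : ∀ v (C : Subgroup (Γ.VGroup v)), Γ.IsEdgeSubgroup v C →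
      (⟨v, C⟩ : Σ v, Subgroup (Γ.VGroup v)) ∈ Set.range f := by
    rintro _ _ (e | e)
    exacts [⟨Sum.inl e, rfl⟩, ⟨Sum.inr e, rfl⟩]
  exact this v C hC

/-- The cosets of the edge subgroups at `v` are coarsely connected inside `G_v`, with
uniform constants. -/
lemma exists_linked_edgeSubgroup [Finite E]
    (hedge : ∀ e (ψ : Character (Γ.EGroup e)), CoarselyConnected ψ) (v : V)
    (ψ : Character (Γ.VGroup v)) :
    ∃ S : Set (Γ.VGroup v), S.Finite ∧ ∃ D : ℝ, 0 ≤ D ∧ ∀ C, Γ.IsEdgeSubgroup v C →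
      ∀ k, ∀ b ∈ C, ∀ c ≤ ψ.val k, c ≤ ψ.val (k * b) → Linked S ψ (c - D) k (k * b) := by
  have hone : ∀ C, Γ.IsEdgeSubgroup v C → ∃ S : Set (Γ.VGroup v), S.Finite ∧ ∃ D : ℝ, 0 ≤ D ∧
      ∀ k, ∀ b ∈ C, ∀ c ≤ ψ.val k, c ≤ ψ.val (k * b) → Linked S ψ (c - D) k (k * b) := by
    intro C hC
    have main : ∀ (A : Type _) [Group A] (i : A →* Γ.VGroup v), CoarselyConnected (ψ.res i) →
        ∃ S : Set (Γ.VGroup v), S.Finite ∧ ∃ D : ℝ, 0 ≤ D ∧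
        ∀ k, ∀ b ∈ i.range, ∀ c ≤ ψ.val k, c ≤ ψ.val (k * b) →
          Linked S ψ (c - D) k (k * b) := by
      rintro A _ i ⟨S, hS, D, hD0, hD⟩
      refine ⟨i '' S, hS.image i, D, hD0, ?_⟩
      rintro k _ ⟨a, rfl⟩ c hc hc'
      rw [ψ.val_mul] at hc'
      have p := hD 1 a (c - ψ.val k) (by simpa using hc) (by rw [Character.val_res]; linarith)
      have := (p.map i (S := i '' S) fun s hs => ⟨s, hs, rfl⟩).translate k
      rw [map_one, mul_one] at this
      exact this.mono subset_rfl (by linarith)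
    cases hC with
    | src e => exact main _ (Γ.srcHom e) (hedge e _)
    | tgt e => exact main _ (Γ.tgtHom e) (hedge e _)
  have hfin := Γ.finite_isEdgeSubgroup v
  choose! S hS D hD0 hD using hone
  obtain ⟨M, hM⟩ := (hfin.image D).bddAbove
  refine ⟨⋃ C ∈ {C | Γ.IsEdgeSubgroup v C}, S C, hfin.biUnion hS, max M 0,
    le_max_right _ _, fun C hC k b hb c hc hc' => ?_⟩
  have : D C ≤ M := hM ⟨C, hC, rfl⟩
  exact (hD C hC k b hb c hc hc').mono (Set.subset_biUnion_of_mem (u := S) hC)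
    (by linarith [le_max_left M 0])

/-- A move issuing from the coset `g G_v` either stays in the coset or leads beyond
an edge issuing from it. -/
lemma IsMaximalTree.adjacent_cases (hT : Γ.IsMaximalTree T) {F : Set (Σ v, Γ.VGroup v)} {v : V}
    {g : Γ.FundGroup T} {y : Γ.FundGroup T × V} (h : Γ.Adjacent T F (g, v) y) :
    (∃ a : Γ.VGroup v, (⟨v, a⟩ ∈ F ∨ ⟨v, a⁻¹⟩ ∈ F) ∧ y = (g * Γ.vertexHom T v a, v)) ∨
    ∃ C H, Γ.IsEdgeSubgroup v C ∧ Γ.IsHalfSpace T v C H ∧ (g⁻¹ * y.1, y.2) ∈ H := by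
  generalize hx : (g, v) = x at h
  obtain h | h := h
  · cases h with
    | vertex k w a ha =>
      obtain ⟨rfl, rfl⟩ := Prod.mk.inj hx
      exact Or.inl ⟨a, Or.inl ha, rfl⟩
    | edge k f =>
      obtain ⟨rfl, rfl⟩ := Prod.mk.inj hx
      obtain ⟨H, hH⟩ := hT.exists_isWall f
      refine Or.inr ⟨_, H, .src f, hH.isHalfSpace_src, ?_⟩
      simpa using hH.tgt
  · cases h with
    | vertex k w a ha =>
      obtain ⟨rfl, rfl⟩ := Prod.mk.inj hx
      exact Or.inl ⟨a⁻¹, Or.inr (by simpa using ha), by simp⟩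
    | edge k f =>
      obtain ⟨rfl, rfl⟩ := Prod.mk.inj hx
      obtain ⟨H, hH⟩ := hT.exists_isWall f
      refine Or.inr ⟨_, _, .tgt f, hH.isHalfSpace_tgt, ?_⟩
      simpa [mul_assoc] using hH.src

/-- If a character of the fundamental group is coarsely connected, so are its restrictions to the
vertex groups, provided the edge groups are coarsely connected for all characters. A path with ends
in `G_v` that leaves `G_v` through an edge must come back through the same edge, so each excursion
can be replaced by a path in a coset of the edge group. -/
theorem IsMaximalTree.coarselyConnected_res [Finite E] (hT : Γ.IsMaximalTree T)
    (hedge : ∀ e (ψ : Character (Γ.EGroup e)), CoarselyConnected ψ)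
    {φ : Character (Γ.FundGroup T)} (hφ : CoarselyConnected φ) (v : V) :
    CoarselyConnected (φ.res (Γ.vertexHom T v)) := by
  set ψ := φ.res (Γ.vertexHom T v) with hψ
  obtain ⟨S, hS, D, hD0, hD⟩ := exists_linked_edgeSubgroup hedge v ψ
  obtain ⟨F, hF, D', hD'⟩ := hT.exists_joined_of_coarselyConnected hφ v
  have hFv : {a : Γ.VGroup v | ⟨v, a⟩ ∈ F}.Finite := hF.preimage sigma_mk_injective.injOn
  set S' : Set (Γ.VGroup v) := S ∪ ({a | ⟨v, a⟩ ∈ F} ∪ (·⁻¹) '' {a | ⟨v, a⟩ ∈ F}) with hS'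
  refine coarselyConnected_of_one (S := S') (hS.union (hFv.union (hFv.image _)))
    (D := D' + D) fun a ha => ?_
  have p := hD' 1 (Γ.vertexHom T v a) 0 (by simp) ha
  rw [zero_sub] at p
  -- Either the path is in `G_v`, or it is beyond an edge that it entered at `k ∈ G_v`.
  suffices key : ∀ x, Joined F φ (-D') (1, v) x →
      (∃ b, x = (Γ.vertexHom T v b, v) ∧ Linked S' ψ (-(D' + D)) 1 b) ∨
      ∃ C H k, Γ.IsEdgeSubgroup v C ∧ Γ.IsHalfSpace T v C H ∧ -D' ≤ ψ.val k ∧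
        Linked S' ψ (-(D' + D)) 1 k ∧ ((Γ.vertexHom T v k)⁻¹ * x.1, x.2) ∈ H by
    obtain ⟨b, hb, hl⟩ | ⟨C, H, k, -, hH, -, -, hmem⟩ := key _ p
    · rwa [hT.vertexHom_injective v (Prod.mk.inj hb).1]
    · rw [← map_inv, ← map_mul] at hmem
      have := hH.vertex 1 v (k⁻¹ * a)
      rw [one_mul] at this
      exact absurd (this.1 hmem) hH.base
  intro x p
  induction p with
  | refl => exact Or.inl ⟨1, by rw [map_one], Relation.ReflTransGen.refl⟩
  | @tail x y _ h ih =>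
    obtain ⟨h1, h2, hadj⟩ := h
    obtain ⟨b, rfl, hl⟩ | ⟨C, H, k, hC, hH, hk, hl, hmem⟩ := ih
    · obtain ⟨s, hs, rfl⟩ | ⟨C, H, hC, hH, hmem⟩ := hT.adjacent_cases hadj
      · refine Or.inl ⟨b * s, by rw [map_mul], hl.trans (Linked.step ?_ ?_ ?_)⟩
        · rcases hs with hs | hs
          · exact Or.inr (Or.inl hs)
          · exact Or.inr (Or.inr ⟨s⁻¹, hs, inv_inv s⟩)
        · rw [hψ, Character.val_res]
          dsimp only at h1
          linarith
        · rw [hψ, Character.val_res, map_mul]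
          dsimp only at h2
          linarith
      · exact Or.inr ⟨C, H, b, hC, hH, h1, hl, hmem⟩
    · by_cases hy : ((Γ.vertexHom T v k)⁻¹ * y.1, y.2) ∈ H
      · exact Or.inr ⟨C, H, k, hC, hH, hk, hl, hy⟩
      · obtain ⟨b, hb, he⟩ := hH.exit _ hmem _ hy
          ((hadj.translate _).mono (Set.subset_univ _))
        obtain ⟨he1, he2⟩ := Prod.mk.inj he
        have hy1 : y.1 = Γ.vertexHom T v (k * b) := by
          rw [map_mul, ← he1, mul_inv_cancel_left]
        refine Or.inl ⟨k * b, Prod.ext hy1 he2, hl.trans ?_⟩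
        rw [hy1] at h2
        exact (hD C hC k b hb (-D') hk h2).mono Set.subset_union_left (by linarith)

/-! ### Coarsely connected characters are nonzero on the edge groups -/

/-- If `H` contains the translates of its near base point by `z` and by `z⁻¹`, then `z` maps the
complement of `H` into `H`. -/
lemma IsHalfSpace.mem_or_translate_mem (hT : Γ.IsMaximalTree T) {u : V}
    {C : Subgroup (Γ.VGroup u)} {H : Set (Γ.FundGroup T × V)} (hH : Γ.IsHalfSpace T u C H)
    {z : Γ.FundGroup T} (hz : (z, u) ∈ H) (hz' : (z⁻¹, u) ∈ H) (g : Γ.FundGroup T) (w : V) :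
    (g, w) ∈ H ∨ (z * g, w) ∈ H := by
  have step : ∀ x y, Γ.Adjacent T Set.univ x y → (x ∈ H ∨ (z * x.1, x.2) ∈ H) →
      (y ∈ H ∨ (z * y.1, y.2) ∈ H) := by
    intro x y hadj hx
    by_contra! hy
    rcases hx with hx | hx
    · obtain ⟨b, -, rfl⟩ := hH.exit x hx y hy.1 hadj
      exact hy.2 ((hH.vertex z u b).2 hz)
    · obtain ⟨b, -, he⟩ := hH.exit _ hx _ hy.2 (hadj.translate z)
      obtain ⟨he1, he2⟩ := Prod.mk.inj he
      have : y = (z⁻¹ * Γ.vertexHom T u b, u) :=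
        Prod.ext (by rw [← he1, inv_mul_cancel_left]) he2
      exact hy.1 (this ▸ (hH.vertex z⁻¹ u b).2 hz')
  refine hT.move_induction (P := fun g w => (g, w) ∈ H ∨ (z * g, w) ∈ H) (g₀ := 1) (v₀ := u)
    (Or.inr (by simpa using hz)) ?_ ?_ g w
  · exact fun g w a => step (g, w) _ (Or.inl (.vertex g w a (Set.mem_univ _)))
  · exact fun g f => ⟨step (g, _) (_, _) (Or.inl (.edge g f)),
      step (_, _) (g, _) (Or.inr (.edge g f))⟩

/-- In the situation of `IsHalfSpace.mem_or_translate_mem`, nonzero characters are unbounded above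
on `H`. -/
lemma IsHalfSpace.exists_val_ge (hT : Γ.IsMaximalTree T) {u : V}
    {C : Subgroup (Γ.VGroup u)} {H : Set (Γ.FundGroup T × V)} (hH : Γ.IsHalfSpace T u C H)
    {z : Γ.FundGroup T} (hz : (z, u) ∈ H) (hz' : (z⁻¹, u) ∈ H)
    {φ : Character (Γ.FundGroup T)} (hφ : φ ≠ 0) (w : V) (M : ℝ) :
    ∃ g, (g, w) ∈ H ∧ M ≤ φ.val g := by
  obtain ⟨g, hg⟩ := Character.exists_val_ge hφ (M + |φ.val z|)
  rcases hH.mem_or_translate_mem hT hz hz' g w with h | h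
  · exact ⟨g, h, by linarith [abs_nonneg (φ.val z)]⟩
  · exact ⟨z * g, h, by rw [φ.val_mul]; linarith [neg_abs_le (φ.val z)]⟩

namespace IsWall

variable {e : E} {H : Set (Γ.FundGroup T × V)}

lemma vertexHom_mem (hH : Γ.IsWall T e H) (v : V) (a : Γ.VGroup v) :
    (Γ.vertexHom T v a, v) ∈ H ↔ (1, v) ∈ H := by
  simpa using hH.vertex 1 v a

end IsWall

lemma IsMaximalTree.edgeHom_notMem (hT : Γ.IsMaximalTree T) [Finite E] {f : E}
    {b : Γ.VGroup (Γ.src f)} (hb : b ∉ (Γ.srcHom f).range) :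
    Γ.vertexHom T (Γ.src f) b ∉ (Γ.edgeHom T f).range := by
  rintro ⟨c, hc⟩
  exact hb ⟨c, hT.vertexHom_injective _ hc⟩

lemma IsMaximalTree.stable_conj_notMem (hT : Γ.IsMaximalTree T) [Finite E] {f : E}
    {b : Γ.VGroup (Γ.tgt f)} (hb : b ∉ (Γ.tgtHom f).range) :
    Γ.stable T f * Γ.vertexHom T (Γ.tgt f) b * (Γ.stable T f)⁻¹ ∉ (Γ.edgeHom T f).range := by
  rintro ⟨c, hc⟩
  refine hb ⟨c, hT.vertexHom_injective _ ?_⟩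
  rw [← stable_conj, hc]
  group

/-- If an edge `f ≠ e` issues from `v`, there is an element outside `G_v`
corresponding to a closed path at `v` that avoids the edge `e`. -/
lemma IsMaximalTree.exists_notMem_range_vertexHom [Finite E] (hT : Γ.IsMaximalTree T)
    (hred : Γ.IsReduced) {e f : E} (hfe : f ≠ e) {v : V} (hv : Γ.src f = v ∨ Γ.tgt f = v) :
    ∃ y ∉ (Γ.vertexHom T v).range, ∀ H, Γ.IsWall T e H → ∀ h, (h * y, v) ∈ H ↔ (h, v) ∈ H := by
  obtain ⟨K, hK⟩ := hT.exists_isWall f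
  by_cases hloop : Γ.src f = Γ.tgt f
  · obtain rfl : Γ.src f = v := hv.elim id (hloop.trans ·)
    refine ⟨Γ.stable T f, ?_, fun H hH h => ?_⟩
    · rintro ⟨a, ha⟩
      have h1 := hK.tgt
      rw [← ha, ← hloop, hK.vertexHom_mem] at h1
      exact hK.src h1
    · have := hH.edge_of_ne h f hfe
      rwa [← hloop] at this
  obtain ⟨hs, ht⟩ := hred f hloop
  rcases hv with rfl | rfl
  · obtain ⟨b, hb⟩ := not_forall.1 ht
    refine ⟨Γ.stable T f * Γ.vertexHom T (Γ.tgt f) b * (Γ.stable T f)⁻¹, ?_, fun H hH h => ?_⟩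
    · rintro ⟨a, ha⟩
      have h1 := hK.edge_of_notMem _ (hT.stable_conj_notMem hb)
      rw [inv_mul_cancel_right, hK.vertex, ← ha, hK.vertexHom_mem] at h1
      exact hK.src (h1.1 hK.tgt)
    · rw [← hH.edge_of_ne _ f hfe, ← mul_assoc, ← mul_assoc, inv_mul_cancel_right, hH.vertex,
        hH.edge_of_ne _ f hfe]
  · obtain ⟨b, hb⟩ := not_forall.1 hs
    refine ⟨(Γ.stable T f)⁻¹ * Γ.vertexHom T (Γ.src f) b * Γ.stable T f, ?_, fun H hH h => ?_⟩
    · rintro ⟨a, ha⟩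
      have h1 := hK.edge_of_notMem _ (hT.edgeHom_notMem hb)
      have h2 : Γ.vertexHom T (Γ.src f) b * Γ.stable T f =
          Γ.stable T f * Γ.vertexHom T (Γ.tgt f) a := by rw [ha]; group
      rw [h2, hK.vertex, hK.vertexHom_mem] at h1
      exact hK.src (h1.1 hK.tgt)
    · rw [← mul_assoc, ← mul_assoc, hH.edge_of_ne _ f hfe, hH.vertex,
        ← hH.edge_of_ne _ f hfe, inv_mul_cancel_right]

/-- In a graph of groups that is not an ascending HNN-extension, a loop one of whose edge inclusions
is onto is not the only edge at its vertex. -/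
lemma IsMaximalTree.exists_ne_of_surjective (hT : Γ.IsMaximalTree T)
    (hasc : ¬ Γ.IsAscendingHNN) {e : E} (he : Γ.src e = Γ.tgt e)
    (hs : Function.Surjective (Γ.srcHom e) ∨ Function.Surjective (Γ.tgtHom e)) :
    ∃ f ≠ e, Γ.src f = Γ.src e ∨ Γ.tgt f = Γ.src e := by
  by_cases hV : ∃ v, v ≠ Γ.src e
  · obtain ⟨v, hv⟩ := hV
    obtain ⟨p⟩ := hT.isTree.connected.preconnected (Γ.src e) v
    cases p with
    | nil => exact absurd rfl hv
    | cons hadj _ =>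
      obtain ⟨f, hf, h⟩ := spanningGraph_adj hadj
      refine ⟨f, ?_, h.imp (·.1) (·.2)⟩
      rintro rfl
      exact hT.no_loops _ hf he
  · push Not at hV
    have hcV : Nat.card V = 1 := by
      rw [Nat.card_eq_one_iff_exists]; exact ⟨Γ.src e, hV⟩
    by_contra! hE
    refine hasc ⟨hcV, ?_, e, hs⟩
    rw [Nat.card_eq_one_iff_exists]
    refine ⟨e, fun f => ?_⟩
    by_contra hf
    exact (hE f hf).1 (hV _)

/-- A nonzero character that vanishes on an edge group of a reduced graph of groups, not an
ascending HNN-extension, is not coarsely connected: it is unbounded above on both sides of the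
edge, but bounded on the translates under the edge group, where a path must cross. -/
theorem IsMaximalTree.res_edgeHom_ne_zero [Finite E] (hT : Γ.IsMaximalTree T)
    (hred : Γ.IsReduced) (hasc : ¬ Γ.IsAscendingHNN)
    {φ : Character (Γ.FundGroup T)} (hφ : φ ≠ 0) (hcc : CoarselyConnected φ) (e : E) :
    φ.res (Γ.edgeHom T e) ≠ 0 := by
  intro hzero
  obtain ⟨H, hH⟩ := hT.exists_isWall e
  have hloop : (Function.Surjective (Γ.srcHom e) ∨ Function.Surjective (Γ.tgtHom e)) →
      Γ.src e = Γ.tgt e := fun hs => by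
    by_contra hne
    exact hs.elim (hred e hne).1 (hred e hne).2
  have hfar : ∃ y, (Γ.stable T e * y, Γ.tgt e) ∈ H ∧ (Γ.stable T e * y⁻¹, Γ.tgt e) ∈ H ∧
      Γ.stable T e * y * (Γ.stable T e)⁻¹ ∉ (Γ.edgeHom T e).range := by
    by_cases hs : Function.Surjective (Γ.tgtHom e)
    · have hl := hloop (Or.inr hs)
      obtain ⟨f, hfe, hf⟩ := hT.exists_ne_of_surjective hasc hl (Or.inr hs)
      rw [hl] at hf
      obtain ⟨y, hy, hyH⟩ := hT.exists_notMem_range_vertexHom hred hfe hf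
      refine ⟨y, (hyH H hH _).2 hH.tgt, ?_, ?_⟩
      · rw [← hyH H hH, inv_mul_cancel_right]; exact hH.tgt
      · rintro ⟨c, hc⟩
        refine hy ⟨Γ.tgtHom e c, ?_⟩
        rw [← stable_conj, hc]
        group
    · obtain ⟨b, hb⟩ := not_forall.1 hs
      refine ⟨Γ.vertexHom T (Γ.tgt e) b, (hH.vertex _ _ _).2 hH.tgt, ?_, hT.stable_conj_notMem hb⟩
      rw [← map_inv]
      exact (hH.vertex _ _ _).2 hH.tgt
  have hnear : ∃ y, (y, Γ.src e) ∉ H ∧ (y⁻¹, Γ.src e) ∉ H ∧ y ∉ (Γ.edgeHom T e).range := by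
    by_cases hs : Function.Surjective (Γ.srcHom e)
    · have hl := hloop (Or.inl hs)
      obtain ⟨f, hfe, hf⟩ := hT.exists_ne_of_surjective hasc hl (Or.inl hs)
      obtain ⟨y, hy, hyH⟩ := hT.exists_notMem_range_vertexHom hred hfe hf
      refine ⟨y, fun h => ?_, fun h => ?_, ?_⟩
      · rw [← one_mul y, hyH H hH] at h
        exact hH.src h
      · rw [← hyH H hH, inv_mul_cancel] at h
        exact hH.src h
      · rintro ⟨c, hc⟩
        exact hy ⟨Γ.srcHom e c, hc⟩
    · obtain ⟨b, hb⟩ := not_forall.1 hs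
      refine ⟨Γ.vertexHom T (Γ.src e) b, ?_, ?_, hT.edgeHom_notMem hb⟩
      · rw [hH.vertexHom_mem]; exact hH.src
      · rw [← map_inv, hH.vertexHom_mem]; exact hH.src
  obtain ⟨F, -, D, hD⟩ := hT.exists_joined_of_coarselyConnected hcc (Γ.src e)
  obtain ⟨g, hgH, hg⟩ : ∃ g, (g, Γ.src e) ∈ H ∧ D + 1 ≤ φ.val g := by
    obtain ⟨y, h1, h2, h3⟩ := hfar
    refine hH.isHalfSpace_src.exists_val_ge hT
      (z := Γ.stable T e * y * (Γ.stable T e)⁻¹) ?_ ?_ hφ _ _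
    · rw [← hH.edge_of_notMem _ h3, inv_mul_cancel_right]; exact h1
    · rw [← hH.edge_of_notMem _ (fun h => h3 (inv_mem_iff.1 h))]
      simpa [mul_assoc] using h2
  obtain ⟨k, hkH, hk⟩ : ∃ k, (k, Γ.src e) ∉ H ∧ D + 1 ≤ φ.val k := by
    obtain ⟨y, h1, h2, h3⟩ := hnear
    obtain ⟨k, hkH, hk⟩ := hH.isHalfSpace_tgt.exists_val_ge hT
      (z := (Γ.stable T e)⁻¹ * y * Γ.stable T e) (by
        simp only [Set.mem_ofPred_eq, mul_assoc, mul_inv_cancel_left]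
        rw [hH.edge_of_notMem _ h3]; exact h1) (by
        simp only [Set.mem_ofPred_eq, mul_inv_rev, inv_inv, mul_assoc, mul_inv_cancel_left]
        rw [hH.edge_of_notMem _ (fun h => h3 (inv_mem_iff.1 h))]; exact h2)
      hφ (Γ.src e) (D + 1 - φ.val (Γ.stable T e))
    exact ⟨Γ.stable T e * k, hkH, by rw [φ.val_mul]; linarith⟩
  have p := hD g k (D + 1) hg hk
  rw [add_sub_cancel_left] at p
  have key : ∀ x, Joined F φ 1 (g, Γ.src e) x → x ∈ H := by
    intro x p
    induction p with
    | refl => exact hgH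
    | tail _ h ih =>
      obtain ⟨-, h1, hadj⟩ := h
      by_contra hx
      obtain ⟨_, ⟨c, rfl⟩, rfl⟩ := hH.isHalfSpace_src.exit _ ih _ hx
        (hadj.mono (Set.subset_univ _))
      have : φ.val (Γ.edgeHom T e c) = 0 := by rw [← Character.val_res, hzero]; rfl
      exact absurd (h1.trans_eq this) (by norm_num)
  exact hkH (key _ p)

/-! ### Assembling vertex groups along edge groups -/

lemma val_edgeHom_conj (φ : Character (Γ.FundGroup T)) (e : E) (a : Γ.EGroup e) :
    φ.val (Γ.vertexHom T (Γ.tgt e) (Γ.tgtHom e a)) = φ.val (Γ.edgeHom T e a) := by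
  rw [← stable_conj]; simp

/-- A nonzero character that is nonzero on all edge groups is nonzero on all vertex groups. -/
lemma IsMaximalTree.res_vertexHom_ne_zero (hT : Γ.IsMaximalTree T)
    {φ : Character (Γ.FundGroup T)} (hφ : φ ≠ 0) (he : ∀ e, φ.res (Γ.edgeHom T e) ≠ 0) (v : V) :
    φ.res (Γ.vertexHom T v) ≠ 0 := by
  intro hv
  have hval : ∀ a, φ.val (Γ.vertexHom T v a) = 0 := fun a => by
    rw [← Character.val_res, hv]; rfl
  have hsrc : ∀ e, Γ.src e ≠ v := by
    rintro e rfl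
    exact he e (Character.ext_val fun a => hval (Γ.srcHom e a))
  have htgt : ∀ e, Γ.tgt e ≠ v := by
    rintro e rfl
    exact he e (Character.ext_val fun a => by
      rw [Character.val_res, ← val_edgeHom_conj, hval]; rfl)
  have hV : ∀ w, w = v := by
    intro w
    obtain ⟨p⟩ := hT.isTree.connected.preconnected v w
    cases p with
    | nil => rfl
    | cons hadj _ =>
      obtain ⟨f, -, h | h⟩ := spanningGraph_adj hadj
      exacts [absurd h.1 (hsrc f), absurd h.2 (htgt f)]
  refine hφ (Character.ext_val fun g => ?_)
  induction g using fundGroup_induction with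
  | vertex w a => obtain rfl := hV w; exact hval a
  | stable e => exact absurd (hV _) (hsrc e)
  | one => exact φ.val_one
  | mul x y hx hy => rw [φ.val_mul, hx, hy]; exact add_zero 0
  | inv x hx => rw [φ.val_inv, hx]; exact neg_zero

/-- If `φ` is nonzero on all edge groups and coarsely connected on all vertex groups, then it is
coarsely connected. Inside `{φ ≥ 0}` one passes from a coset `g G_{src e}` to the
coset `g t_e G_{tgt e}` by first moving up along `G_e`. -/
theorem IsMaximalTree.coarselyConnected_of_res [Finite V] [Finite E] (hT : Γ.IsMaximalTree T)
    {φ : Character (Γ.FundGroup T)} (he : ∀ e, φ.res (Γ.edgeHom T e) ≠ 0)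
    (hv : ∀ v, CoarselyConnected (φ.res (Γ.vertexHom T v))) : CoarselyConnected φ := by
  choose A hA D hD0 hD using hv
  obtain ⟨M, hM⟩ := (Set.finite_range D).bddAbove
  have hM : ∀ v, D v ≤ M := fun v => hM ⟨v, rfl⟩
  set S : Set (Γ.FundGroup T) :=
    (⋃ v, Γ.vertexHom T v '' A v) ∪ Set.range (Γ.stable T) with hS
  have hSfin : S.Finite :=
    (Set.finite_iUnion fun v => (hA v).image _).union (Set.finite_range _)
  have hM0 : 0 ≤ M := by
    obtain ⟨v⟩ := hT.isTree.connected.nonempty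
    exact (hD0 v).trans (hM v)
  have hcoset : ∀ g v a b, 0 ≤ φ.val (g * Γ.vertexHom T v a) →
      0 ≤ φ.val (g * Γ.vertexHom T v b) →
      Linked S φ (-M) (g * Γ.vertexHom T v a) (g * Γ.vertexHom T v b) := by
    intro g v a b ha hb
    rw [φ.val_mul] at ha hb
    have p := hD v a b (-φ.val g) (by rw [Character.val_res]; linarith)
      (by rw [Character.val_res]; linarith)
    have := (p.map (Γ.vertexHom T v) (S := S)
      fun s hs => Or.inl (Set.mem_iUnion.2 ⟨v, s, hs, rfl⟩)).translate g
    exact this.mono subset_rfl (by linarith [hM v])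
  have hedge : ∀ g f, ∃ c : Γ.EGroup f,
      0 ≤ φ.val (g * Γ.edgeHom T f c) ∧ 0 ≤ φ.val (g * Γ.edgeHom T f c * Γ.stable T f) := by
    intro g f
    obtain ⟨c, hc⟩ := Character.exists_val_ge (he f)
      (max (-φ.val g) (-(φ.val g + φ.val (Γ.stable T f))))
    rw [Character.val_res] at hc
    have h1 := (le_max_left _ _).trans hc
    have h2 := (le_max_right _ _).trans hc
    exact ⟨c, by rw [φ.val_mul]; linarith, by rw [φ.val_mul, φ.val_mul]; linarith⟩
  obtain ⟨v₀⟩ := hT.isTree.connected.nonempty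
  have key := hT.move_induction (g₀ := 1) (v₀ := v₀) (P := fun g w =>
    ∀ a, 0 ≤ φ.val (g * Γ.vertexHom T w a) → Linked S φ (-M) 1 (g * Γ.vertexHom T w a))
    (fun a ha => by simpa using hcoset 1 v₀ 1 a (by simp) ha)
    (fun g w b h a ha => by
      rw [mul_assoc, ← map_mul] at ha ⊢
      exact h _ ha)
    (fun g f => by
      obtain ⟨c, hc1, hc2⟩ := hedge g f
      have hstep : Linked S φ (-M) (g * Γ.edgeHom T f c) (g * Γ.edgeHom T f c * Γ.stable T f) :=
        Linked.step (Or.inr ⟨f, rfl⟩) (by linarith) (by linarith)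
      rw [mul_assoc g, edgeHom_mul_stable, ← mul_assoc] at hc2 hstep
      exact ⟨fun h a ha => ((h (Γ.srcHom f c) hc1).trans hstep).trans (hcoset _ _ _ a hc2 ha),
        fun h a ha => ((h _ hc2).trans hstep.symm).trans
          (hcoset g _ (Γ.srcHom f c) a hc1 ha)⟩)
  refine coarselyConnected_of_one hSfin (D := M) fun g hg => ?_
  simpa using key g v₀ 1 (by simpa using hg)

end GraphOfGroups

end BNS

theorem corollary2p8 {V E : Type*} [Finite V] [Finite E] (Γ : BNS.GraphOfGroups V E)
    (T : Set E) (hT : Γ.IsMaximalTree T) (hred : Γ.IsReduced) (hasc : ¬ Γ.IsAscendingHNN)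
    (hfg : Group.FG (Γ.FundGroup T)) (hedge : ∀ e, BNS.InVarsigma (Γ.EGroup e)) :
    (∀ v, Group.FG (Γ.VGroup v)) ∧
    (∀ (φ : BNS.Character (Γ.FundGroup T)) (hφ : φ ≠ 0),
      BNS.cls φ hφ ∈ BNS.bnsInvariant (Γ.FundGroup T) ↔
        (∀ e, φ.res (Γ.edgeHom T e) ≠ 0) ∧
        ∀ v, ∃ hv : φ.res (Γ.vertexHom T v) ≠ 0,
          BNS.cls (φ.res (Γ.vertexHom T v)) hv ∈ BNS.bnsInvariant (Γ.VGroup v)) ∧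
    BNS.bnsInvariant (Γ.FundGroup T) =
      (⋂ e, (BNS.vanishingSphere (Γ.edgeHom T e))ᶜ) ∩
      ⋂ v, Subtype.val ''
        (BNS.resSphere (Γ.vertexHom T v) ⁻¹' BNS.bnsInvariant (Γ.VGroup v)) := by
  have hcc : ∀ e (ψ : BNS.Character (Γ.EGroup e)), BNS.CoarselyConnected ψ :=
    fun e => (hedge e).coarselyConnected
  have hiff : ∀ (φ : BNS.Character (Γ.FundGroup T)) (hφ : φ ≠ 0),
      BNS.cls φ hφ ∈ BNS.bnsInvariant (Γ.FundGroup T) ↔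
        (∀ e, φ.res (Γ.edgeHom T e) ≠ 0) ∧
        ∀ v, ∃ hv : φ.res (Γ.vertexHom T v) ≠ 0,
          BNS.cls (φ.res (Γ.vertexHom T v)) hv ∈ BNS.bnsInvariant (Γ.VGroup v) := by
    intro φ hφ
    rw [BNS.cls_mem_bnsInvariant_iff]
    constructor
    · intro h
      have he := hT.res_edgeHom_ne_zero hred hasc hφ h
      exact ⟨he, fun v => ⟨hT.res_vertexHom_ne_zero hφ he v,
        (BNS.cls_mem_bnsInvariant_iff _ _).2 (hT.coarselyConnected_res hcc h v)⟩⟩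
    · rintro ⟨he, hv⟩
      exact hT.coarselyConnected_of_res he fun v =>
        (BNS.cls_mem_bnsInvariant_iff _ (hv v).1).1 (hv v).2
  refine ⟨fun v => ?_, hiff, ?_⟩
  · exact (hT.coarselyConnected_res hcc (BNS.coarselyConnected_zero_iff.2 hfg) v).fg
  · ext x
    induction x using Module.Ray.ind with
    | h φ hφ =>
      refine (hiff φ hφ).trans (and_congr ?_ ?_)
      · simp only [Set.mem_iInter, Set.mem_compl_iff]
        exact forall_congr' fun e => not_congr (BNS.cls_mem_vanishingSphere _ φ hφ).symm
      · rw [Set.mem_iInter]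
        refine forall_congr' fun v => ⟨fun ⟨hv, h⟩ => ?_, ?_⟩
        · exact ⟨⟨BNS.cls φ hφ, fun hn => hv ((BNS.cls_mem_vanishingSphere _ φ hφ).1 hn)⟩,
            by rwa [Set.mem_preimage, BNS.resSphere_cls _ φ hφ hv], rfl⟩
        · rintro ⟨⟨_, hn⟩, h, rfl⟩
          have hv : φ.res (Γ.vertexHom T v) ≠ 0 := fun h0 =>
            hn ((BNS.cls_mem_vanishingSphere _ φ hφ).2 h0)
          refine ⟨hv, ?_⟩
          rwa [Set.mem_preimage, BNS.resSphere_cls _ φ hφ hv] at h
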